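/- Let $q$ be a complex number with $0<|q|<1$. Write $(a;q)_\infty=\prod_{m\ge 0}(1-aq^m)$ and $$G(q)=\frac{1}{(q;q^5)_\infty(q^4;q^5)_\infty},\qquad H(q)=\frac{1}{(q^2;q^5)_\infty(q^3;q^5)_\infty}.$$ Consider the following three identities, in which $\sum_m$ is over all integers $m$ and $\sum_m'$ is over all nonzero integers $m$: (A) $$-\sum_{m}{}'(-1)^m\frac{q^{(5m^2+m-2)/2}}{1-q^{5m}}+\sum_{m}(-1)^m\frac{q^{(5m^2-m-2)/2}}{1-q^{5m-1}}+2\sum_{m}{}'(-1)^m\frac{q^{(5m^2+3m-2)/2}}{1-q^{5m}}+2\sum_{m}(-1)^m\frac{q^{(5m^2+7m)/2}}{1-q^{5m+2}}=(q^5;q^5)_\infty^2\frac{H(q)^3}{G(q)^2};$$ (B) $$\frac1{q^2}\sum_{j=0}^\infty\left(\frac{q^{5j+2}}{1-q^{5j+1}}-\frac{q^{5j+5}}{1-q^{5j+4}}-3\,\frac{q^{5j+3}}{1-q^{5j+2}}+3\,\frac{q^{5j+4}}{1-q^{5j+3}}\right)=(q^5;q^5)_\infty^2\frac{H(q)^3}{G(q)^2};$$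 (C) $$\sum_{m=0}^\infty\frac{q^m(1-q^{m+1})^3}{1-q^{5m+5}}=(q^5;q^5)_\infty^2\frac{H(q)^3}{G(q)^2}.$$ Then all the series converge absolutely, the left-hand sides of (A), (B) and (C) are equal, and consequently (A), (B) and (C) are equivalent. -/

import Mathlib

noncomputable section

namespace CrankModFive

/-- The infinite `q`-Pochhammer symbol `(a; q)_∞ = ∏_{m ≥ 0} (1 - a q^m)`. -/
def qPoch (a q : ℂ) : ℂ := ∏' m : ℕ, (1 - a * q ^ m)

/-- For `|q| < 1` the product defining `(a; q)_∞` converges, so `qPoch` is its true value. -/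
theorem multipliable_qPoch (a : ℂ) {q : ℂ} (hq : ‖q‖ < 1) :
    Multipliable fun m : ℕ => 1 - a * q ^ m := by
  have h : Summable fun m : ℕ => -(a * q ^ m) :=
    ((summable_geometric_of_norm_lt_one hq).mul_left a).neg
  simpa [sub_eq_add_neg] using Complex.multipliable_one_add_of_summable h

/-- The Rogers-Ramanujan product `G(q) = 1 / ((q; q^5)_∞ (q^4; q^5)_∞)`. -/
def G (q : ℂ) : ℂ := 1 / (qPoch q (q ^ 5) * qPoch (q ^ 4) (q ^ 5))

/-- The Rogers-Ramanujan product `H(q) = 1 / ((q^2; q^5)_∞ (q^3; q^5)_∞)`. -/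
def H (q : ℂ) : ℂ := 1 / (qPoch (q ^ 2) (q ^ 5) * qPoch (q ^ 3) (q ^ 5))

/-- The common right-hand side `(q^5; q^5)_∞^2 H(q)^3 / G(q)^2`. -/
def rhs (q : ℂ) : ℂ := qPoch (q ^ 5) (q ^ 5) ^ 2 * (H q ^ 3 / G q ^ 2)

/-! Summands of the four bilateral series of form (A). All exponents `_ / 2` below are exact
integer divisions: the numerators are even for every integer `m`. -/

def termA1 (q : ℂ) (m : ℤ) : ℂ :=
  (-1) ^ m * (q ^ ((5 * m ^ 2 + m - 2) / 2) / (1 - q ^ (5 * m)))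

def termA2 (q : ℂ) (m : ℤ) : ℂ :=
  (-1) ^ m * (q ^ ((5 * m ^ 2 - m - 2) / 2) / (1 - q ^ (5 * m - 1)))

def termA3 (q : ℂ) (m : ℤ) : ℂ :=
  (-1) ^ m * (q ^ ((5 * m ^ 2 + 3 * m - 2) / 2) / (1 - q ^ (5 * m)))

def termA4 (q : ℂ) (m : ℤ) : ℂ :=
  (-1) ^ m * (q ^ ((5 * m ^ 2 + 7 * m) / 2) / (1 - q ^ (5 * m + 2)))

/-- Left-hand side of (A); the first and third series omit the index `m = 0`. -/
def lhsA (q : ℂ) : ℂ :=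
  -(∑' m : {m : ℤ // m ≠ 0}, termA1 q m) + (∑' m : ℤ, termA2 q m)
    + 2 * (∑' m : {m : ℤ // m ≠ 0}, termA3 q m) + 2 * (∑' m : ℤ, termA4 q m)

/-- Summand of form (B). -/
def termB (q : ℂ) (j : ℕ) : ℂ :=
  q ^ (5 * j + 2) / (1 - q ^ (5 * j + 1)) - q ^ (5 * j + 5) / (1 - q ^ (5 * j + 4))
    - 3 * (q ^ (5 * j + 3) / (1 - q ^ (5 * j + 2)))
    + 3 * (q ^ (5 * j + 4) / (1 - q ^ (5 * j + 3)))

/-- Left-hand side of (B). -/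
def lhsB (q : ℂ) : ℂ := 1 / q ^ 2 * ∑' j : ℕ, termB q j

/-- Summand of form (C). -/
def termC (q : ℂ) (m : ℕ) : ℂ := q ^ m * (1 - q ^ (m + 1)) ^ 3 / (1 - q ^ (5 * m + 5))

/-- Left-hand side of (C). -/
def lhsC (q : ℂ) : ℂ := ∑' m : ℕ, termC q m

/-- The identity (A) at `q`. -/
def FormA (q : ℂ) : Prop := lhsA q = rhs q

/-- The identity (B) at `q`. -/
def FormB (q : ℂ) : Prop := lhsB q = rhs q

/-- The identity (C) at `q`. -/
def FormC (q : ℂ) : Prop := lhsC q = rhs q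

end CrankModFive

end

noncomputable section

namespace CrankModFive

open Filter Topology

variable {p q : ℂ}

/-! All three left-hand sides equal `q⁻¹ * lambertSum q`, a combination of the Lambert series L(z) =
∑ z p^k / (1 - z p^k) with p = q^5 and z = q, q^2, q^3, q^4. The product side is never evaluated.
For (B) this is a regrouping; for (C) the cube is expanded and each Lambert series is summed in the
other order (`hasSum_lambert_swap`).

The substance is (A), whose four series are Appell sums A(w; x). In θ(a) A(1; a/z) - z θ(a/z) A(z;
a), expanded in powers of a, the coefficient of (-1)^N p^(N(N-1)/2) a^N has the form c(z) - N
(`laurentCoeff_eq`). At z = a the expression vanishes; subtracting that case removes the -N and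
leaves θ(a) (c(z) - c(a)) (`theta_mul_appell_sub`). Clausen's transformation gives c(z) = L(p/z) -
L(z) (`laurentCoeff_zero`). For (a, z) = (q^3, q) and (q, q^2) the two thetas agree up to a
monomial, and they cancel because the Jacobi triple product shows θ(a) ≠ 0. -/

/-! ### Triangular exponents and convergence of bilateral series -/

/-- The exponent `n (n - 1) / 2`. -/
def tri (n : ℤ) : ℤ := n * (n - 1) / 2

theorem two_mul_tri (n : ℤ) : 2 * tri n = n * (n - 1) := by
  unfold tri
  exact Int.mul_ediv_cancel' (Int.even_mul_pred_self n).two_dvd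

theorem tri_add_one (n : ℤ) : tri (n + 1) = tri n + n := by
  have h1 := two_mul_tri n
  have h2 := two_mul_tri (n + 1)
  linarith [mul_comm n (n - 1), show (n + 1) * (n + 1 - 1) = n * (n - 1) + 2 * n by ring]

theorem tri_neg (n : ℤ) : tri (-n) = tri (n + 1) := by
  unfold tri
  congr 1
  ring

@[simp] theorem tri_zero : tri 0 = 0 := rfl

theorem neg_one_zpow_neg (n : ℤ) : (-1 : ℂ) ^ (-n) = (-1) ^ n := by
  rw [← inv_zpow', inv_neg, inv_one]

/-- A function on `ℤ` whose terms have eventually small ratios in both directions is summable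
in norm. -/
theorem summable_norm_int_of_ratio {f : ℤ → ℂ} (hf : ∀ n, f n ≠ 0)
    (hpos : Tendsto (fun n : ℕ => f (n + 1) / f n) atTop (𝓝 0))
    (hneg : Tendsto (fun n : ℕ => f (-(n + 1)) / f (-n)) atTop (𝓝 0)) :
    Summable fun n => ‖f n‖ := by
  refine Summable.of_nat_of_neg ?_ ?_
  · refine (summable_of_ratio_test_tendsto_lt_one (l := 0) zero_lt_one
      (.of_forall fun n => norm_ne_zero_iff.2 (hf _)) ?_)
    simpa [norm_div] using hpos.norm
  · refine (summable_of_ratio_test_tendsto_lt_one (l := 0) zero_lt_one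
      (.of_forall fun n => norm_ne_zero_iff.2 (hf _)) ?_)
    simpa [norm_div] using hneg.norm

theorem summable_norm_zpow_tri (hp0 : p ≠ 0) (hp : ‖p‖ < 1) {x : ℂ} (hx : x ≠ 0) :
    Summable fun n : ℤ => ‖p ^ tri n * x ^ n‖ := by
  have hpow := tendsto_pow_atTop_nhds_zero_of_norm_lt_one hp
  refine summable_norm_int_of_ratio (fun n => by positivity) ?_ ?_
  · have : Tendsto (fun n : ℕ => p ^ n * x) atTop (𝓝 0) := by simpa using hpow.mul_const x
    refine this.congr fun n => ?_
    rw [tri_add_one, zpow_add₀ hp0, zpow_add_one₀ hx, zpow_natCast p n]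
    have := zpow_ne_zero (tri n) hp0
    have := zpow_ne_zero (n : ℤ) hx
    field_simp
  · have : Tendsto (fun n : ℕ => p ^ (n + 1) * x⁻¹) atTop (𝓝 0) := by
      simpa using ((tendsto_add_atTop_iff_nat 1).2 hpow).mul_const x⁻¹
    refine this.congr fun n => ?_
    rw [tri_neg, tri_neg, tri_add_one (n + 1), zpow_add₀ hp0, neg_add, zpow_add₀ hx, zpow_neg_one]
    have := zpow_ne_zero (tri (n + 1)) hp0
    have := zpow_ne_zero (-n : ℤ) hx
    rw [show ((n : ℤ) + 1) = ((n + 1 : ℕ) : ℤ) by push_cast; rfl, zpow_natCast p (n + 1)]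
    field_simp

/-- The inverse tends to 1 as n → ∞ and, for w ≠ 0, to 0 as n → -∞. A vanishing denominator is
harmless since `0⁻¹ = 0`. -/
theorem exists_norm_inv_one_sub_mul_zpow_le (hp0 : p ≠ 0) (hp : ‖p‖ < 1) (w : ℂ) :
    ∃ K : ℝ, ∀ n : ℤ, ‖(1 - w * p ^ n)⁻¹‖ ≤ K := by
  by_cases hw : w = 0
  · exact ⟨1, fun n => by simp [hw]⟩
  have hpow := tendsto_pow_atTop_nhds_zero_of_norm_lt_one hp
  have h1 : Tendsto (fun n : ℕ => (1 - w * p ^ n)⁻¹) atTop (𝓝 1) := by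
    simpa using (((hpow.const_mul w).const_sub 1).inv₀ (by simp))
  have h2 : Tendsto (fun n : ℕ => p ^ n * (p ^ n - w)⁻¹) atTop (𝓝 0) := by
    simpa using hpow.mul ((hpow.sub_const w).inv₀ (by simpa using hw))
  obtain ⟨K₁, hK₁⟩ := h1.norm.bddAbove_range
  obtain ⟨K₂, hK₂⟩ := h2.norm.bddAbove_range
  refine ⟨max K₁ K₂, fun n => ?_⟩
  obtain ⟨n, rfl | rfl⟩ := n.eq_nat_or_neg
  · exact le_max_of_le_left (by simpa using hK₁ ⟨n, rfl⟩)
  · refine le_max_of_le_right (le_of_eq_of_le ?_ (hK₂ ⟨n, rfl⟩))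
    have : p ^ n ≠ 0 := pow_ne_zero n hp0
    rw [show 1 - w * p ^ (-n : ℤ) = (p ^ n - w) * (p ^ n)⁻¹ by
      rw [zpow_neg, zpow_natCast]; field_simp, mul_inv, inv_inv, mul_comm]

/-- Dividing by `1 - w p ^ n` preserves absolute convergence. -/
theorem summable_norm_div_one_sub (hp0 : p ≠ 0) (hp : ‖p‖ < 1) (w : ℂ) {f : ℤ → ℂ}
    (hf : Summable fun n => ‖f n‖) : Summable fun n => ‖f n / (1 - w * p ^ n)‖ := by
  obtain ⟨K, hK⟩ := exists_norm_inv_one_sub_mul_zpow_le hp0 hp w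
  refine (hf.mul_right K).of_nonneg_of_le (fun n => norm_nonneg _) fun n => ?_
  rw [div_eq_mul_inv, norm_mul]
  exact mul_le_mul_of_nonneg_left (hK n) (norm_nonneg _)

/-! ### Theta functions and Appell sums -/

/-- The summand of `theta`. -/
def thetaTerm (p x : ℂ) (n : ℤ) : ℂ := (-1) ^ n * (p ^ tri n * x ^ n)

/-- The theta function `∑ (-1)^n p^(n(n-1)/2) x^n`. -/
def theta (p x : ℂ) : ℂ := ∑' n : ℤ, thetaTerm p x n

/-- The summand of `appell`. -/
def appellTerm (p w x : ℂ) (n : ℤ) : ℂ :=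
  (-1) ^ n * (p ^ tri (n + 1) * x ^ n) / (1 - w * p ^ n)

/-- The Appell sum `∑ (-1)^n p^(n(n+1)/2) x^n / (1 - w p^n)`. A summand with vanishing denominator
contributes `0`; in particular `appell p 1 x` is the sum over nonzero `n`. -/
def appell (p w x : ℂ) : ℂ := ∑' n : ℤ, appellTerm p w x n

theorem summable_norm_thetaTerm (hp0 : p ≠ 0) (hp : ‖p‖ < 1) {x : ℂ} (hx : x ≠ 0) :
    Summable fun n => ‖thetaTerm p x n‖ := by
  simpa [thetaTerm, norm_mul] using summable_norm_zpow_tri hp0 hp hx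

theorem summable_norm_appellTerm (hp0 : p ≠ 0) (hp : ‖p‖ < 1) (w : ℂ) {x : ℂ} (hx : x ≠ 0) :
    Summable fun n => ‖appellTerm p w x n‖ := by
  refine summable_norm_div_one_sub hp0 hp w ?_
  convert summable_norm_zpow_tri hp0 hp (mul_ne_zero hp0 hx) using 2 with n
  rw [tri_add_one, zpow_add₀ hp0, mul_zpow]
  simp [mul_assoc]

theorem theta_mul_left (hp0 : p ≠ 0) {x : ℂ} (hx : x ≠ 0) : theta p x = -x * theta p (p * x) := by
  unfold theta
  rw [← tsum_mul_left, ← (Equiv.addRight (1 : ℤ)).tsum_eq]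
  refine tsum_congr fun n => ?_
  simp only [thetaTerm, Equiv.coe_addRight, tri_add_one, mul_zpow, zpow_add₀ hp0, zpow_add₀ hx,
    zpow_add₀ (neg_ne_zero.2 (one_ne_zero (α := ℂ))), zpow_one]
  ring

theorem theta_inv (hp0 : p ≠ 0) (x : ℂ) : theta p x⁻¹ = theta p (p * x) := by
  unfold theta
  rw [← (Equiv.neg ℤ).tsum_eq]
  refine tsum_congr fun n => ?_
  simp only [thetaTerm, Equiv.neg_apply, tri_neg, tri_add_one, mul_zpow, zpow_add₀ hp0, inv_zpow',
    neg_neg, neg_one_zpow_neg]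
  ring

/-- The two functional equations at x = 1 give θ(1) = -θ(p) and θ(1) = θ(p). -/
theorem theta_one (hp0 : p ≠ 0) : theta p 1 = 0 := by
  have h1 := theta_mul_left hp0 one_ne_zero
  have h2 := theta_inv hp0 1
  rw [inv_one] at h2
  rw [← h2] at h1
  linear_combination h1 / 2

/-- Substitute n ↦ -n. The identity `key` survives vanishing denominators, so w = 1 is allowed. -/
theorem appell_reflect (hp0 : p ≠ 0) {w : ℂ} (hw : w ≠ 0) (x : ℂ) :
    appell p w x = -w⁻¹ * appell p w⁻¹ x⁻¹ := by
  unfold appell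
  rw [← tsum_mul_left, ← (Equiv.neg ℤ).tsum_eq]
  refine tsum_congr fun n => ?_
  have hpn := zpow_ne_zero n hp0
  have key : (1 - w * p ^ (-n))⁻¹ = -w⁻¹ * p ^ n * (1 - w⁻¹ * p ^ n)⁻¹ := by
    rw [show 1 - w * p ^ (-n) = (-w⁻¹ * p ^ n)⁻¹ * (1 - w⁻¹ * p ^ n) by
      rw [zpow_neg]; field_simp; ring, mul_inv, inv_inv]
  simp only [appellTerm, Equiv.neg_apply, div_eq_mul_inv]
  rw [key, show -n + 1 = -(n - 1) by ring, tri_neg, sub_add_cancel, tri_add_one,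
    zpow_add₀ hp0, neg_one_zpow_neg, zpow_neg x, inv_zpow]
  ring

theorem appell_one_one (hp0 : p ≠ 0) : appell p 1 1 = 0 := by
  have h := appell_reflect hp0 one_ne_zero 1
  simp only [inv_one] at h
  linear_combination h / 2

/-- The `N`-th Laurent coefficient, up to normalization, of a product of a theta function and an
Appell sum. -/
def crossTerm (p w y : ℂ) (N n : ℤ) : ℂ := p ^ (n ^ 2 + n - n * N) * y ^ n / (1 - w * p ^ n)

/-- The sum of `crossTerm`. -/
def crossSum (p w y : ℂ) (N : ℤ) : ℂ := ∑' n : ℤ, crossTerm p w y N n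

theorem summable_norm_gauss (hp0 : p ≠ 0) (hp : ‖p‖ < 1) {y : ℂ} (hy : y ≠ 0) (c : ℤ) :
    Summable fun n : ℤ => ‖p ^ (n ^ 2 + c * n) * y ^ n‖ := by
  convert summable_norm_zpow_tri (pow_ne_zero 2 hp0)
    (by rw [norm_pow]; exact pow_lt_one₀ (norm_nonneg p) hp two_ne_zero)
    (mul_ne_zero (zpow_ne_zero (c + 1) hp0) hy) using 2 with n
  rw [mul_zpow, ← mul_assoc, ← zpow_natCast, ← zpow_mul, ← zpow_mul, ← zpow_add₀ hp0]
  congr 3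
  have := two_mul_tri n
  push_cast
  linarith [show n ^ 2 = n * (n - 1) + n by ring]

theorem summable_crossTerm (hp0 : p ≠ 0) (hp : ‖p‖ < 1) (w : ℂ) {y : ℂ} (hy : y ≠ 0) (N : ℤ) :
    Summable (crossTerm p w y N) := by
  refine (summable_norm_div_one_sub hp0 hp w ?_).of_norm
  convert summable_norm_gauss hp0 hp hy (1 - N) using 5
  ring

/-- Expansion of a product of a theta function and an Appell sum in powers of `b`. -/
theorem hasSum_theta_mul_appell (hp0 : p ≠ 0) (hp : ‖p‖ < 1) (w : ℂ) {b c : ℂ} (hb : b ≠ 0)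
    (hc : c ≠ 0) :
    HasSum (fun N => thetaTerm p b N * crossSum p w (c / b) N) (theta p b * appell p w c) := by
  have h1 := summable_norm_thetaTerm hp0 hp hb
  have h2 := summable_norm_appellTerm hp0 hp w hc
  have h3 := summable_mul_of_summable_norm h1 h2
  have h4 : HasSum (fun x : ℤ × ℤ => thetaTerm p b x.1 * appellTerm p w c x.2)
      (theta p b * appell p w c) := by
    unfold theta appell
    rw [tsum_mul_tsum_of_summable_norm h1 h2]
    exact h3.hasSum
  -- Group the double series by the total exponent N, with c/b held fixed.
  let e : ℤ × ℤ ≃ ℤ × ℤ :=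
    { toFun := fun x => (x.1 - x.2, x.2)
      invFun := fun x => (x.1 + x.2, x.2)
      left_inv := fun x => by simp
      right_inv := fun x => by simp }
  rw [← e.hasSum_iff] at h4
  refine h4.prod_fiberwise fun N => ?_
  refine ((summable_crossTerm hp0 hp w (div_ne_zero hc hb) N).hasSum.mul_left
    (thetaTerm p b N)).congr_fun fun n => ?_
  simp only [e, Function.comp, Equiv.coe_fn_mk, thetaTerm, appellTerm, crossTerm]
  have e1 : (-1 : ℂ) ^ (N - n) * (-1) ^ n = (-1) ^ N := by
    rw [← zpow_add₀ (by norm_num), sub_add_cancel]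
  have e2 : p ^ tri (N - n) * p ^ tri (n + 1) = p ^ tri N * p ^ (n ^ 2 + n - n * N) := by
    rw [← zpow_add₀ hp0, ← zpow_add₀ hp0]
    congr 1
    have h1 := two_mul_tri (N - n)
    have h2 := two_mul_tri (n + 1)
    have h3 := two_mul_tri N
    nlinarith
  have e3 : b ^ (N - n) * c ^ n = b ^ N * (c / b) ^ n := by
    rw [zpow_sub₀ hb, div_zpow]
    ring
  linear_combination (p ^ tri (N - n) * p ^ tri (n + 1) * (b ^ (N - n) * c ^ n)
      / (1 - w * p ^ n)) * e1 + ((-1) ^ N * (b ^ (N - n) * c ^ n) / (1 - w * p ^ n)) * e2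
    + ((-1) ^ N * (p ^ tri N * p ^ (n ^ 2 + n - n * N)) / (1 - w * p ^ n)) * e3

/-- The normalized Laurent coefficients of the difference of two theta-Appell products. -/
def laurentCoeff (p z : ℂ) (N : ℤ) : ℂ := crossSum p 1 z⁻¹ N - z ^ (1 - N) * crossSum p z z N

/-- Raising N by one cancels the denominators and leaves the same Gaussian sum from both cross sums,
up to n ↦ N - n. The -1 is the missing n = 0 term at w = 1. -/
theorem laurentCoeff_add_one (hp0 : p ≠ 0) (hp : ‖p‖ < 1) {z : ℂ} (hz0 : z ≠ 0)
    (hz : ∀ n : ℤ, z * p ^ n ≠ 1) (N : ℤ) :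
    laurentCoeff p z (N + 1) = laurentCoeff p z N - 1 := by
  have hp1 : ∀ n : ℤ, n ≠ 0 → p ^ n ≠ 1 := fun n hn h => by
    have := congrArg norm h
    rw [norm_zpow, norm_one, zpow_eq_one_iff_right₀ (norm_nonneg p) hp.ne] at this
    exact hn this
  have hg (y : ℂ) (hy : y ≠ 0) : Summable fun n : ℤ => p ^ (n ^ 2 - n * N) * y ^ n := by
    refine (summable_norm_gauss hp0 hp hy (-N)).of_norm.congr fun n => ?_
    rw [show n ^ 2 + -N * n = n ^ 2 - n * N by ring]
  have hstep (n : ℤ) : p ^ (n ^ 2 + n - n * N) = p ^ (n ^ 2 - n * N) * p ^ n := by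
    rw [← zpow_add₀ hp0]; congr 1; ring
  have hstep' (n : ℤ) : p ^ (n ^ 2 + n - n * (N + 1)) = p ^ (n ^ 2 - n * N) := by
    congr 1; ring
  have h1 : crossSum p 1 z⁻¹ (N + 1) - crossSum p 1 z⁻¹ N
      = (∑' n : ℤ, p ^ (n ^ 2 - n * N) * z⁻¹ ^ n) - 1 := by
    have hz1 := inv_ne_zero hz0
    refine ((summable_crossTerm hp0 hp 1 hz1 (N + 1)).hasSum.sub
      (summable_crossTerm hp0 hp 1 hz1 N).hasSum).unique
      (((hg _ hz1).hasSum.sub (hasSum_ite_eq (0 : ℤ) (1 : ℂ))).congr_fun fun n => ?_)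
    rw [crossTerm, crossTerm, hstep, hstep']
    -- At n = 0 both cross terms are 0 by division by zero, whereas the Gaussian term is 1.
    split_ifs with hn
    · simp [hn]
    · have : 1 - p ^ n ≠ 0 := sub_ne_zero.2 (hp1 n hn).symm
      field_simp
      ring
  have h2 : z ^ (1 - (N + 1)) * crossSum p z z (N + 1) - z ^ (1 - N) * crossSum p z z N
      = ∑' n : ℤ, p ^ (n ^ 2 - n * N) * z⁻¹ ^ n := by
    rw [crossSum, crossSum, ← tsum_mul_left, ← tsum_mul_left,
      ← ((summable_crossTerm hp0 hp z hz0 _).mul_left _).tsum_sub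
      ((summable_crossTerm hp0 hp z hz0 _).mul_left _), ← (Equiv.subLeft N).tsum_eq fun n : ℤ =>
        p ^ (n ^ 2 - n * N) * z⁻¹ ^ n]
    refine tsum_congr fun n => ?_
    rw [crossTerm, crossTerm, hstep, hstep', Equiv.subLeft_apply,
      show (N - n) ^ 2 - (N - n) * N = n ^ 2 - n * N by ring, inv_zpow', neg_sub,
      show 1 - N = 1 + -N by ring, show 1 - (N + 1) = -N by ring, sub_eq_add_neg n,
      zpow_add₀ hz0, zpow_add₀ hz0, zpow_one]
    have : 1 - z * p ^ n ≠ 0 := sub_ne_zero.2 (hz n).symm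
    field_simp
  unfold laurentCoeff
  linear_combination h1 - h2

theorem laurentCoeff_eq (hp0 : p ≠ 0) (hp : ‖p‖ < 1) {z : ℂ} (hz0 : z ≠ 0)
    (hz : ∀ n : ℤ, z * p ^ n ≠ 1) (N : ℤ) :
    laurentCoeff p z N = laurentCoeff p z 0 - N := by
  induction N using Int.induction_on with
  | zero => simp
  | succ n ih => rw [laurentCoeff_add_one hp0 hp hz0 hz, ih]; push_cast; ring
  | pred n ih =>
    have := laurentCoeff_add_one hp0 hp hz0 hz (-n - 1)
    rw [sub_add_cancel, ih] at this
    push_cast at this ⊢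
    linear_combination -this

/-- Apply the expansion with (b, c) = (a, a/z) and (a/z, a), so that both products are series in the
same monomials. -/
theorem hasSum_laurentCoeff (hp0 : p ≠ 0) (hp : ‖p‖ < 1) {a z : ℂ} (ha : a ≠ 0) (hz : z ≠ 0) :
    HasSum (fun N => thetaTerm p a N * laurentCoeff p z N)
      (theta p a * appell p 1 (a / z) - z * (theta p (a / z) * appell p z a)) := by
  have h1 := hasSum_theta_mul_appell hp0 hp 1 ha (div_ne_zero ha hz)
  have h2 := (hasSum_theta_mul_appell hp0 hp z (div_ne_zero ha hz) ha).mul_left z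
  refine (h1.sub h2).congr_fun fun N => ?_
  rw [div_div_cancel₀ ha, div_div_cancel_left' ha, laurentCoeff, thetaTerm, thetaTerm, div_zpow,
    zpow_sub₀ hz, zpow_one]
  ring

/-- The relation between Appell sums whose arguments differ by a common shift. -/
theorem theta_mul_appell_sub (hp0 : p ≠ 0) (hp : ‖p‖ < 1) {a z : ℂ} (ha0 : a ≠ 0) (hz0 : z ≠ 0)
    (ha : ∀ n : ℤ, a * p ^ n ≠ 1) (hz : ∀ n : ℤ, z * p ^ n ≠ 1) :
    theta p a * appell p 1 (a / z) - z * (theta p (a / z) * appell p z a)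
      = theta p a * (laurentCoeff p z 0 - laurentCoeff p a 0) := by
  -- The subtracted instance z = a has sum 0, and it carries the same -N in its coefficients.
  have h1 := (hasSum_laurentCoeff hp0 hp ha0 hz0).sub (hasSum_laurentCoeff hp0 hp ha0 ha0)
  rw [div_self ha0, theta_one hp0, appell_one_one hp0] at h1
  have h2 := (summable_norm_thetaTerm hp0 hp ha0).of_norm.hasSum.mul_right
    (laurentCoeff p z 0 - laurentCoeff p a 0)
  rw [← theta] at h2
  have h3 := h1.unique (h2.congr_fun fun N => ?_)
  · linear_combination h3
  · rw [laurentCoeff_eq hp0 hp hz0 hz, laurentCoeff_eq hp0 hp ha0 ha]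
    ring

/-! ### Lambert series -/

/-- The Lambert series `∑ z p^k / (1 - z p^k)`. -/
def lambert (p z : ℂ) : ℂ := ∑' k : ℕ, z * p ^ k / (1 - z * p ^ k)

theorem norm_mul_pow_lt_one {p z : ℂ} (hp : ‖p‖ < 1) (hz : ‖z‖ < 1) (k : ℕ) :
    ‖z * p ^ k‖ < 1 := by
  rw [norm_mul, norm_pow]
  exact mul_lt_one_of_nonneg_of_lt_one_left (norm_nonneg z) hz
    (pow_le_one₀ (norm_nonneg p) hp.le)

theorem one_sub_ne_zero_of_norm_lt_one {x : ℂ} (hx : ‖x‖ < 1) : 1 - x ≠ 0 := by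
  refine sub_ne_zero.2 fun h => ?_
  rw [← h, norm_one] at hx
  exact lt_irrefl _ hx

theorem hasSum_pow_succ {x : ℂ} (hx : ‖x‖ < 1) :
    HasSum (fun n : ℕ => x ^ (n + 1)) (x / (1 - x)) := by
  simpa [pow_succ', div_eq_mul_inv] using (hasSum_geometric_of_norm_lt_one hx).mul_left x

/-- The summand of the double series of `lambert`. -/
def lambertTerm (p z : ℂ) (x : ℕ × ℕ) : ℂ := (z * p ^ x.2) ^ (x.1 + 1)

theorem summable_lambertTerm (hp : ‖p‖ < 1) {z : ℂ} (hz : ‖z‖ < 1) :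
    Summable (lambertTerm p z) := by
  have h1 : Summable fun n : ℕ => ‖z ^ (n + 1)‖ := (hasSum_pow_succ hz).summable.norm
  have h2 : Summable fun n : ℕ => ‖p ^ n‖ := (summable_geometric_of_norm_lt_one hp).norm
  refine Summable.of_norm_bounded (summable_mul_of_summable_norm h1 h2).norm fun x => ?_
  rw [lambertTerm, mul_pow, ← pow_mul, norm_mul, norm_mul, norm_pow p, norm_pow p]
  exact mul_le_mul_of_nonneg_left (pow_le_pow_of_le_one (norm_nonneg p) hp.le (by nlinarith))
    (norm_nonneg _)

theorem hasSum_lambertTerm_left (hp : ‖p‖ < 1) {z : ℂ} (hz : ‖z‖ < 1) (k : ℕ) :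
    HasSum (fun n : ℕ => lambertTerm p z (n, k)) (z * p ^ k / (1 - z * p ^ k)) := by
  refine HasSum.congr_fun (hasSum_pow_succ (norm_mul_pow_lt_one hp hz k)) fun n => ?_
  rw [lambertTerm]

theorem summable_lambertTerm_swap (hp : ‖p‖ < 1) {z : ℂ} (hz : ‖z‖ < 1) :
    Summable fun x : ℕ × ℕ => lambertTerm p z (x.2, x.1) :=
  (summable_lambertTerm hp hz).comp_injective Prod.swap_injective

theorem hasSum_lambert (hp : ‖p‖ < 1) {z : ℂ} (hz : ‖z‖ < 1) :
    HasSum (fun k : ℕ => z * p ^ k / (1 - z * p ^ k)) (lambert p z) :=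
  ((summable_lambertTerm_swap hp hz).hasSum.prod_fiberwise
    fun k => hasSum_lambertTerm_left hp hz k).summable.hasSum

theorem hasSum_lambertTerm (hp : ‖p‖ < 1) {z : ℂ} (hz : ‖z‖ < 1) :
    HasSum (lambertTerm p z) (lambert p z) := by
  have h := ((summable_lambertTerm_swap hp hz).hasSum.prod_fiberwise
    fun k => hasSum_lambertTerm_left hp hz k).tsum_eq
  rw [lambert, h, show ∑' x : ℕ × ℕ, lambertTerm p z (x.2, x.1) = ∑' x, lambertTerm p z x from
    (Equiv.prodComm ℕ ℕ).tsum_eq (lambertTerm p z)]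
  exact (summable_lambertTerm hp hz).hasSum

/-- Interchanging the order of summation in a Lambert series. -/
theorem hasSum_lambert_swap (hp : ‖p‖ < 1) {z : ℂ} (hz : ‖z‖ < 1) :
    HasSum (fun n : ℕ => z ^ (n + 1) / (1 - p ^ (n + 1))) (lambert p z) := by
  refine (hasSum_lambertTerm hp hz).prod_fiberwise fun n => ?_
  have hpn : ‖p ^ (n + 1)‖ < 1 := by
    rw [norm_pow]; exact pow_lt_one₀ (norm_nonneg p) hp n.succ_ne_zero
  refine ((hasSum_geometric_of_norm_lt_one hpn).mul_left (z ^ (n + 1))).congr_fun fun k => ?_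
  rw [lambertTerm, mul_pow, ← pow_mul, ← pow_mul, mul_comm k]

/-- The pairs of naturals, split according to `n < k` or `k ≤ n`. -/
def splitEquiv : (ℕ × ℕ) ⊕ (ℕ × ℕ) ≃ ℕ × ℕ where
  toFun := Sum.elim (fun x => (x.1, x.1 + 1 + x.2)) fun x => (x.1 + x.2, x.1)
  invFun x := if x.1 < x.2 then .inl (x.1, x.2 - x.1 - 1) else .inr (x.2, x.1 - x.2)
  left_inv := by
    rintro (⟨a, b⟩ | ⟨a, b⟩)
    · simp [show a < a + 1 + b by omega, show a + 1 + b - a - 1 = b by omega]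
    · simp
  right_inv := by
    rintro ⟨a, b⟩
    by_cases h : a < b
    · simp [h]
      omega
    · simp [h]
      omega

/-- The upper half of Clausen's transformation of the Lambert series. -/
def clausenUpper (p z : ℂ) : ℂ :=
  ∑' n : ℕ, z ^ (n + 1) * p ^ ((n + 1) ^ 2) / (1 - p ^ (n + 1))

/-- The lower half of Clausen's transformation of the Lambert series. -/
def clausenLower (p z : ℂ) : ℂ := ∑' k : ℕ, z ^ (k + 1) * p ^ (k ^ 2 + k) / (1 - z * p ^ k)

theorem hasSum_clausenUpper_fiber (hp : ‖p‖ < 1) (z : ℂ) (n : ℕ) :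
    HasSum (fun k : ℕ => lambertTerm p z (n, n + 1 + k))
      (z ^ (n + 1) * p ^ ((n + 1) ^ 2) / (1 - p ^ (n + 1))) := by
  have hpn : ‖p ^ (n + 1)‖ < 1 := by
    rw [norm_pow]; exact pow_lt_one₀ (norm_nonneg p) hp n.succ_ne_zero
  refine ((hasSum_geometric_of_norm_lt_one hpn).mul_left
    (z ^ (n + 1) * p ^ ((n + 1) ^ 2))).congr_fun fun k => ?_
  rw [lambertTerm]
  ring

theorem hasSum_clausenLower_fiber (hp : ‖p‖ < 1) {z : ℂ} (hz : ‖z‖ < 1) (k : ℕ) :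
    HasSum (fun i : ℕ => lambertTerm p z (k + i, k))
      (z ^ (k + 1) * p ^ (k ^ 2 + k) / (1 - z * p ^ k)) := by
  refine ((hasSum_geometric_of_norm_lt_one (norm_mul_pow_lt_one hp hz k)).mul_left
    (z ^ (k + 1) * p ^ (k ^ 2 + k))).congr_fun fun i => ?_
  rw [lambertTerm]
  ring

theorem summable_clausenUpper_double (hp : ‖p‖ < 1) {z : ℂ} (hz : ‖z‖ < 1) :
    Summable fun x : ℕ × ℕ => lambertTerm p z (x.1, x.1 + 1 + x.2) :=
  (summable_lambertTerm hp hz).comp_injective (splitEquiv.injective.comp Sum.inl_injective)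

theorem summable_clausenLower_double (hp : ‖p‖ < 1) {z : ℂ} (hz : ‖z‖ < 1) :
    Summable fun x : ℕ × ℕ => lambertTerm p z (x.1 + x.2, x.1) :=
  (summable_lambertTerm hp hz).comp_injective (splitEquiv.injective.comp Sum.inr_injective)

theorem hasSum_clausenUpper (hp : ‖p‖ < 1) {z : ℂ} (hz : ‖z‖ < 1) :
    HasSum (fun n : ℕ => z ^ (n + 1) * p ^ ((n + 1) ^ 2) / (1 - p ^ (n + 1)))
      (clausenUpper p z) :=
  ((summable_clausenUpper_double hp hz).hasSum.prod_fiberwise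
    fun n => hasSum_clausenUpper_fiber hp z n).summable.hasSum

theorem hasSum_clausenLower (hp : ‖p‖ < 1) {z : ℂ} (hz : ‖z‖ < 1) :
    HasSum (fun k : ℕ => z ^ (k + 1) * p ^ (k ^ 2 + k) / (1 - z * p ^ k)) (clausenLower p z) :=
  ((summable_clausenLower_double hp hz).hasSum.prod_fiberwise
    fun k => hasSum_clausenLower_fiber hp hz k).summable.hasSum

/-- Clausen's transformation. -/
theorem lambert_eq_clausen (hp : ‖p‖ < 1) {z : ℂ} (hz : ‖z‖ < 1) :
    lambert p z = clausenUpper p z + clausenLower p z := by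
  have h1 := (summable_clausenUpper_double hp hz).hasSum
  have h2 := (summable_clausenLower_double hp hz).hasSum
  rw [← (h1.prod_fiberwise fun n => hasSum_clausenUpper_fiber hp z n).tsum_eq] at h1
  rw [← (h2.prod_fiberwise fun k => hasSum_clausenLower_fiber hp hz k).tsum_eq] at h2
  -- Cut the double series along the diagonal: rows are summed for n < k, columns for k ≤ n.
  exact (splitEquiv.hasSum_iff.2 (hasSum_lambertTerm hp hz)).unique (HasSum.sum h1 h2)

/-! ### The constant Laurent coefficient as a difference of Lambert series -/

theorem crossSum_one_inv (hp0 : p ≠ 0) (hp : ‖p‖ < 1) {z : ℂ} (hz0 : z ≠ 0) (hz : ‖z‖ < 1)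
    (hpz : ‖p / z‖ < 1) :
    crossSum p 1 z⁻¹ 0 = clausenUpper p (p / z) - clausenUpper p z := by
  have h1 := hasSum_clausenUpper hp hpz
  have h2 := hasSum_clausenUpper hp hz
  have h3 : HasSum (crossTerm p 1 z⁻¹ 0) (clausenUpper p (p / z) + -clausenUpper p z) := by
    refine HasSum.of_nat_of_neg_add_one ?_ (h2.neg.congr_fun fun n => ?_)
    -- The n = 0 term has denominator 0 and contributes nothing, so the sum starts at n = 1.
    · rw [← hasSum_nat_add_iff' 1]
      simp only [Finset.sum_range_one]
      rw [show crossTerm p 1 z⁻¹ 0 ((0 : ℕ) : ℤ) = 0 by simp [crossTerm], sub_zero]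
      refine h1.congr_fun fun n => ?_
      simp only [crossTerm]
      rw [show ((n + 1 : ℕ) : ℤ) ^ 2 + ((n + 1 : ℕ) : ℤ) - ((n + 1 : ℕ) : ℤ) * 0
          = (((n + 1) ^ 2 + (n + 1) : ℕ) : ℤ) by push_cast; ring]
      simp only [zpow_natCast, pow_add _ ((n + 1) ^ 2), div_pow, inv_pow]
      ring
    · simp only [crossTerm]
      rw [show (-((n : ℤ) + 1)) ^ 2 + -((n : ℤ) + 1) - -((n : ℤ) + 1) * 0
          = (((n + 1) ^ 2 : ℕ) : ℤ) - ((n + 1 : ℕ) : ℤ) by push_cast; ring,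
        show -((n : ℤ) + 1) = -((n + 1 : ℕ) : ℤ) by push_cast; ring, inv_zpow', neg_neg,
        zpow_sub₀ hp0, zpow_neg]
      simp only [zpow_natCast]
      have h0 := pow_ne_zero (n + 1) hp0
      have h1 : 1 - p ^ (n + 1) ≠ 0 := one_sub_ne_zero_of_norm_lt_one (by
        rw [norm_pow]; exact pow_lt_one₀ (norm_nonneg p) hp n.succ_ne_zero)
      rw [show 1 - 1 * (p ^ (n + 1))⁻¹ = -((1 - p ^ (n + 1)) * (p ^ (n + 1))⁻¹) by
        field_simp; ring]
      field_simp
  rw [crossSum, h3.tsum_eq, sub_eq_add_neg]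

theorem crossSum_self (hp0 : p ≠ 0) (hp : ‖p‖ < 1) {z : ℂ} (hz0 : z ≠ 0) (hz : ‖z‖ < 1)
    (hpz : ‖p / z‖ < 1) :
    z * crossSum p z z 0 = clausenLower p z - clausenLower p (p / z) := by
  have h1 := hasSum_clausenLower hp hz
  have h2 := hasSum_clausenLower hp hpz
  have h3 : HasSum (fun n => z * crossTerm p z z 0 n)
      (clausenLower p z + -clausenLower p (p / z)) := by
    refine HasSum.of_nat_of_neg_add_one (h1.congr_fun fun n => ?_) (h2.neg.congr_fun fun n => ?_)
    · simp only [crossTerm]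
      rw [show (n : ℤ) ^ 2 + (n : ℤ) - (n : ℤ) * 0 = ((n ^ 2 + n : ℕ) : ℤ) by push_cast; ring]
      simp only [zpow_natCast]
      ring
    · simp only [crossTerm]
      rw [show (-((n : ℤ) + 1)) ^ 2 + -((n : ℤ) + 1) - -((n : ℤ) + 1) * 0
          = ((n ^ 2 + n : ℕ) : ℤ) by push_cast; ring,
        show -((n : ℤ) + 1) = -((n + 1 : ℕ) : ℤ) by push_cast; ring, zpow_neg, zpow_neg]
      simp only [zpow_natCast]
      have h0 := pow_ne_zero (n + 1) hp0
      have h1 : 1 - p / z * p ^ n ≠ 0 :=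
        one_sub_ne_zero_of_norm_lt_one (norm_mul_pow_lt_one hp hpz n)
      rw [show 1 - z * (p ^ (n + 1))⁻¹ = -((1 - p / z * p ^ n) * (z * (p ^ (n + 1))⁻¹)) by
        field_simp; ring, div_pow, pow_succ z]
      have h2 := pow_ne_zero n hz0
      field_simp
  rw [crossSum, ← tsum_mul_left, h3.tsum_eq, sub_eq_add_neg]

/-- The two cross sums supply the upper and lower Clausen halves at z and at p/z, which recombine.
-/
theorem laurentCoeff_zero (hp0 : p ≠ 0) (hp : ‖p‖ < 1) {z : ℂ} (hz0 : z ≠ 0) (hz : ‖z‖ < 1)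
    (hpz : ‖p / z‖ < 1) : laurentCoeff p z 0 = lambert p (p / z) - lambert p z := by
  rw [laurentCoeff, sub_zero, zpow_one, crossSum_one_inv hp0 hp hz0 hz hpz,
    crossSum_self hp0 hp hz0 hz hpz, lambert_eq_clausen hp hz, lambert_eq_clausen hp hpz]
  ring

/-! ### The Jacobi triple product -/

/-- The finite product `(p; p)_n`. -/
def qFact (p : ℂ) (n : ℕ) : ℂ := ∏ k ∈ Finset.range n, (1 - p ^ (k + 1))

/-- The reciprocal of `(p; p)_m`, extended by zero to negative `m`. -/
def invQFact (p : ℂ) (m : ℤ) : ℂ := if 0 ≤ m then (qFact p m.toNat)⁻¹ else 0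

theorem one_sub_pow_succ_ne_zero (hp : ‖p‖ < 1) (k : ℕ) : 1 - p ^ (k + 1) ≠ 0 :=
  one_sub_ne_zero_of_norm_lt_one (by
    rw [norm_pow]; exact pow_lt_one₀ (norm_nonneg p) hp k.succ_ne_zero)

theorem qFact_succ (n : ℕ) : qFact p (n + 1) = qFact p n * (1 - p ^ (n + 1)) :=
  Finset.prod_range_succ _ _

theorem invQFact_natCast (n : ℕ) : invQFact p n = (qFact p n)⁻¹ := by
  simp [invQFact]

theorem invQFact_of_neg {m : ℤ} (hm : m < 0) : invQFact p m = 0 := if_neg hm.not_ge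

/-- Extension by zero makes this recurrence valid at every integer, so the q-Pascal steps below need
no boundary cases. -/
theorem invQFact_sub_one (hp : ‖p‖ < 1) (m : ℤ) :
    invQFact p (m - 1) = (1 - p ^ m) * invQFact p m := by
  rcases lt_trichotomy m 0 with hm | rfl | hm
  · rw [invQFact_of_neg hm, invQFact_of_neg (by omega), mul_zero]
  · rw [invQFact_of_neg (by omega), zpow_zero, sub_self, zero_mul]
  · obtain ⟨n, rfl⟩ : ∃ n : ℕ, m = ((n + 1 : ℕ) : ℤ) := ⟨(m - 1).toNat, by omega⟩
    rw [invQFact_natCast, show ((n + 1 : ℕ) : ℤ) - 1 = n by push_cast; ring, invQFact_natCast,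
      qFact_succ, zpow_natCast, mul_inv]
    field_simp [one_sub_pow_succ_ne_zero hp n]

theorem tendsto_qFact (hp : ‖p‖ < 1) : Tendsto (qFact p) atTop (𝓝 (qPoch p p)) := by
  refine (multipliable_qPoch p hp).hasProd.tendsto_prod_nat.congr fun n => ?_
  simp only [qFact, pow_succ']

theorem qPoch_ne_zero (hp : ‖p‖ < 1) {x : ℂ} (hx : ∀ n : ℕ, x * p ^ n ≠ 1) : qPoch x p ≠ 0 := by
  have h := tprod_one_add_ne_zero_of_summable (f := fun n : ℕ => -(x * p ^ n))
    (fun n h => hx n (by linear_combination -h))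
    ((summable_geometric_of_norm_lt_one hp).mul_left x).neg.norm
  simpa [qPoch, sub_eq_add_neg] using h

theorem qPoch_self_ne_zero (hp : ‖p‖ < 1) : qPoch p p ≠ 0 :=
  qPoch_ne_zero hp fun n h => one_sub_pow_succ_ne_zero hp n (by rw [pow_succ', h, sub_self])

/-- The finite form of the Jacobi triple product. -/
theorem hasSum_finite_triple (hp0 : p ≠ 0) (hp : ‖p‖ < 1) {z : ℂ} (hz : z ≠ 0) (n l : ℕ) :
    HasSum (fun m : ℤ => thetaTerm p z m * (qFact p (n + l) * (invQFact p (l + m) *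
      invQFact p (n - m))))
      ((∏ k ∈ Finset.range n, (1 - z * p ^ k)) * ∏ k ∈ Finset.range l, (1 - p / z * p ^ k)) := by
  induction l with
  | zero =>
    simp only [Finset.range_zero, Finset.prod_empty, mul_one, Nat.cast_zero, zero_add, add_zero]
    induction n with
    | zero =>
      refine (hasSum_ite_eq (0 : ℤ) (1 : ℂ)).congr_fun fun m => ?_
      split_ifs with hm
      · simp [hm, thetaTerm, qFact, invQFact]
      · rcases lt_or_gt_of_ne hm with h | h
        · simp [invQFact_of_neg h]
        · rw [invQFact_of_neg (show ((0 : ℕ) : ℤ) - m < 0 by simpa using h)]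
          simp
    | succ n ih =>
      rw [Finset.prod_range_succ, mul_sub, mul_one, mul_comm _ (z * p ^ n)]
      -- The new factor 1 - z p^n subtracts a shifted copy of the sum; termwise this is the q-Pascal
      -- rule.
      refine (ih.sub (((Equiv.subRight (1 : ℤ)).hasSum_iff.2 ih).mul_left
        (z * p ^ n))).congr_fun fun m => ?_
      have e1 := invQFact_sub_one hp m
      have e2 := invQFact_sub_one hp (n + 1 - m)
      rw [show (n : ℤ) + 1 - m - 1 = n - m by ring] at e2
      have e3 : thetaTerm p z (m - 1) * (z * p ^ n) = -thetaTerm p z m * p ^ ((n : ℤ) + 1 - m) := by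
        have h := tri_add_one (m - 1)
        rw [sub_add_cancel] at h
        have h' : p ^ tri m * p ^ ((n : ℤ) + 1 - m) = p ^ tri (m - 1) * p ^ n := by
          rw [← zpow_natCast p n, ← zpow_add₀ hp0, ← zpow_add₀ hp0]
          congr 1
          linarith
        rw [thetaTerm, thetaTerm, zpow_sub_one₀ hz, zpow_sub_one₀ (by norm_num : (-1 : ℂ) ≠ 0)]
        field_simp
        linear_combination h'
      have e4 : p ^ m * p ^ ((n : ℤ) + 1 - m) = p ^ (n + 1) := by
        rw [← zpow_add₀ hp0, ← zpow_natCast]; congr 1; push_cast; ring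
      simp only [Function.comp, Equiv.subRight_apply]
      rw [show (n : ℤ) - (m - 1) = n + 1 - m by ring, e1, e2, qFact_succ]
      push_cast
      linear_combination (qFact p n * ((1 - p ^ m) * invQFact p m * invQFact p (n + 1 - m))) * e3
        + thetaTerm p z m * qFact p n * invQFact p m * invQFact p (n + 1 - m) * e4
  | succ l ih =>
    rw [Finset.prod_range_succ, ← mul_assoc, mul_sub, mul_one, mul_comm _ (p / z * p ^ l)]
    refine (ih.sub (((Equiv.addRight (1 : ℤ)).hasSum_iff.2 ih).mul_left
      (p / z * p ^ l))).congr_fun fun m => ?_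
    have e1 := invQFact_sub_one hp (l + 1 + m)
    have e2 := invQFact_sub_one hp (n - m)
    rw [show (l : ℤ) + 1 + m - 1 = l + m by ring] at e1
    have e3 : thetaTerm p z (m + 1) * (p / z * p ^ l)
        = -thetaTerm p z m * p ^ ((l : ℤ) + 1 + m) := by
      have h' : p ^ tri m * p ^ ((l : ℤ) + 1 + m) = p ^ tri (m + 1) * (p * p ^ l) := by
        rw [← pow_succ', ← zpow_natCast p (l + 1), ← zpow_add₀ hp0, ← zpow_add₀ hp0, tri_add_one]
        congr 1
        push_cast
        ring
      rw [thetaTerm, thetaTerm, zpow_add_one₀ hz, zpow_add_one₀ (by norm_num : (-1 : ℂ) ≠ 0)]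
      field_simp
      linear_combination h'
    have e4 : p ^ ((l : ℤ) + 1 + m) * p ^ ((n : ℤ) - m) = p ^ (n + l + 1) := by
      rw [← zpow_add₀ hp0, ← zpow_natCast]; congr 1; push_cast; ring
    simp only [Function.comp, Equiv.coe_addRight]
    rw [show (l : ℤ) + (m + 1) = l + 1 + m by ring, show (n : ℤ) - (m + 1) = n - m - 1 by ring,
      e1, e2, ← add_assoc, qFact_succ]
    push_cast
    linear_combination (qFact p (n + l) * (invQFact p (l + 1 + m) * ((1 - p ^ ((n : ℤ) - m)) *
      invQFact p (n - m)))) * e3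
      + thetaTerm p z m * qFact p (n + l) * invQFact p (l + 1 + m) * invQFact p (n - m) * e4

/-- The Jacobi triple product identity. -/
theorem theta_eq_prod (hp0 : p ≠ 0) (hp : ‖p‖ < 1) {z : ℂ} (hz : z ≠ 0) :
    theta p z = qPoch p p * (qPoch z p * qPoch (p / z) p) := by
  have hP := tendsto_qFact hp
  have hP0 := qPoch_self_ne_zero hp
  have hinv : Tendsto (fun n => (qFact p n)⁻¹) atTop (𝓝 (qPoch p p)⁻¹) := hP.inv₀ hP0
  obtain ⟨K₁, hK₁⟩ := hP.norm.bddAbove_range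
  obtain ⟨K₂, hK₂⟩ := hinv.norm.bddAbove_range
  have hb₁ (n : ℕ) : ‖qFact p n‖ ≤ K₁ := hK₁ ⟨n, rfl⟩
  have hK₁0 : 0 ≤ K₁ := (norm_nonneg _).trans (hb₁ 0)
  have hK₂0 : 0 ≤ K₂ := (norm_nonneg _).trans (hK₂ ⟨0, rfl⟩)
  have hb₂ (m : ℤ) : ‖invQFact p m‖ ≤ K₂ := by
    unfold invQFact
    split_ifs
    · exact hK₂ ⟨_, rfl⟩
    · simpa using hK₂0
  have hlim (m : ℤ) : Tendsto (fun n : ℕ => invQFact p (n + m)) atTop (𝓝 (qPoch p p)⁻¹) := by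
    have ht : Tendsto (fun n : ℕ => ((n : ℤ) + m).toNat) atTop atTop :=
      tendsto_atTop_atTop.2 fun b => ⟨b + m.natAbs, fun n hn => by omega⟩
    refine (hinv.comp ht).congr' ?_
    filter_upwards [eventually_ge_atTop m.natAbs] with n hn
    exact (if_pos (by omega)).symm
  have hlim' (m : ℤ) : Tendsto (fun n : ℕ => invQFact p (n - m)) atTop (𝓝 (qPoch p p)⁻¹) := by
    simpa only [sub_eq_add_neg] using hlim (-m)
  have hP2 : Tendsto (fun n : ℕ => qFact p (n + n)) atTop (𝓝 (qPoch p p)) :=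
    hP.comp (tendsto_atTop_mono (fun n => Nat.le_add_left n n) tendsto_id)
  -- Let n = l → ∞ in the finite form. Since (p; p)_n and its inverse are bounded, a constant
  -- multiple of the theta series dominates.
  have h1 := tendsto_tsum_of_dominated_convergence (𝓕 := atTop)
    (f := fun (n : ℕ) (m : ℤ) => thetaTerm p z m * (qFact p (n + n) * (invQFact p (n + m) *
      invQFact p (n - m))))
    (g := fun m => thetaTerm p z m * (qPoch p p * ((qPoch p p)⁻¹ * (qPoch p p)⁻¹)))
    ((summable_norm_thetaTerm hp0 hp hz).mul_right (K₁ * (K₂ * K₂)))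
    (fun m => (hP2.mul ((hlim m).mul (hlim' m))).const_mul _)
    (.of_forall fun n m => by
      rw [norm_mul, norm_mul, norm_mul]
      gcongr
      · exact hb₁ _
      · exact hb₂ _
      · exact hb₂ _)
  have h2 := ((multipliable_qPoch z hp).hasProd.tendsto_prod_nat.mul
    (multipliable_qPoch (p / z) hp).hasProd.tendsto_prod_nat)
  simp only [(hasSum_finite_triple hp0 hp hz _ _).tsum_eq] at h1
  have h3 := tendsto_nhds_unique h1 h2
  rw [tsum_mul_right, ← theta, ← qPoch, ← qPoch] at h3
  rw [← h3]
  field_simp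

theorem theta_ne_zero (hp0 : p ≠ 0) (hp : ‖p‖ < 1) {z : ℂ} (hz0 : z ≠ 0) (hz : ‖z‖ < 1)
    (hpz : ‖p / z‖ < 1) : theta p z ≠ 0 := by
  rw [theta_eq_prod hp0 hp hz0]
  refine mul_ne_zero (qPoch_self_ne_zero hp) (mul_ne_zero ?_ ?_) <;>
  refine qPoch_ne_zero hp fun n h => ?_
  · simpa [h] using norm_mul_pow_lt_one hp hz n
  · simpa [h] using norm_mul_pow_lt_one hp hpz n

/-! ### Specialization to the base `q ^ 5` -/

theorem norm_pow_lt_one (hq1 : ‖q‖ < 1) {k : ℕ} (hk : k ≠ 0) : ‖q ^ k‖ < 1 := by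
  rw [norm_pow]; exact pow_lt_one₀ (norm_nonneg q) hq1 hk

/-- The exponent k + 5n is never 0, so the norm is not 1. -/
theorem pow_mul_zpow_ne_one (hq0 : q ≠ 0) (hq1 : ‖q‖ < 1) {k : ℕ} (hk : ¬ 5 ∣ k) (n : ℤ) :
    q ^ k * (q ^ 5) ^ n ≠ 1 := fun h => by
  have h' : q ^ ((k : ℤ) + 5 * n) = 1 := by
    rw [zpow_add₀ hq0, zpow_mul, zpow_natCast]; exact_mod_cast h
  have := congrArg norm h'
  rw [norm_zpow, norm_one, zpow_eq_one_iff_right₀ (norm_nonneg q) hq1.ne] at this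
  omega

theorem pow_five_div (hq0 : q ≠ 0) {k l : ℕ} (hkl : k + l = 5) : q ^ 5 / q ^ k = q ^ l := by
  rw [← hkl, pow_add, mul_div_cancel_left₀ _ (pow_ne_zero k hq0)]

theorem laurentCoeff_pow (hq0 : q ≠ 0) (hq1 : ‖q‖ < 1) {k l : ℕ} (hk : k ≠ 0) (hl : l ≠ 0)
    (hkl : k + l = 5) :
    laurentCoeff (q ^ 5) (q ^ k) 0 = lambert (q ^ 5) (q ^ l) - lambert (q ^ 5) (q ^ k) := by
  have h := laurentCoeff_zero (pow_ne_zero 5 hq0) (norm_pow_lt_one hq1 (by norm_num))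
    (pow_ne_zero k hq0) (norm_pow_lt_one hq1 hk)
  rw [pow_five_div hq0 hkl] at h
  exact h (norm_pow_lt_one hq1 hl)

theorem theta_pow_ne_zero (hq0 : q ≠ 0) (hq1 : ‖q‖ < 1) {k l : ℕ} (hk : k ≠ 0) (hl : l ≠ 0)
    (hkl : k + l = 5) : theta (q ^ 5) (q ^ k) ≠ 0 := by
  refine theta_ne_zero (pow_ne_zero 5 hq0) (norm_pow_lt_one hq1 (by norm_num))
    (pow_ne_zero k hq0) (norm_pow_lt_one hq1 hk) ?_
  rw [pow_five_div hq0 hkl]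
  exact norm_pow_lt_one hq1 hl

/-- The first pair of Appell sums as Lambert series. -/
theorem appell_sub_eq_lambert (hq0 : q ≠ 0) (hq1 : ‖q‖ < 1) :
    appell (q ^ 5) 1 (q ^ 2) - q * appell (q ^ 5) q (q ^ 3)
      = lambert (q ^ 5) (q ^ 4) - lambert (q ^ 5) q - lambert (q ^ 5) (q ^ 2)
        + lambert (q ^ 5) (q ^ 3) := by
  have hp0 := pow_ne_zero 5 hq0
  have hz := pow_mul_zpow_ne_one hq0 hq1 (k := 1) (by norm_num)
  have h1 := laurentCoeff_pow hq0 hq1 (k := 1) (l := 4) (by norm_num) (by norm_num) rfl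
  rw [pow_one] at hz h1
  -- Here a = q^3 and z = q; `ht` matches the thetas at a/z = q^2 and a.
  have h := theta_mul_appell_sub hp0 (norm_pow_lt_one hq1 (by norm_num)) (pow_ne_zero 3 hq0) hq0
    (pow_mul_zpow_ne_one hq0 hq1 (by norm_num)) hz
  have ht : theta (q ^ 5) (q ^ 2) = theta (q ^ 5) (q ^ 3) := by
    have h := theta_inv hp0 (q ^ 3)⁻¹
    rwa [inv_inv, ← div_eq_mul_inv, pow_five_div hq0 (l := 2) rfl, eq_comm] at h
  rw [show q ^ 3 / q = q ^ 2 by field_simp, ht, h1,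
    laurentCoeff_pow hq0 hq1 (k := 3) (l := 2) (by norm_num) (by norm_num) rfl] at h
  refine mul_left_cancel₀ (theta_pow_ne_zero hq0 hq1 (k := 3) (l := 2) (by norm_num)
    (by norm_num) rfl) ?_
  linear_combination h

/-- The second pair of Appell sums as Lambert series. -/
theorem appell_add_eq_lambert (hq0 : q ≠ 0) (hq1 : ‖q‖ < 1) :
    appell (q ^ 5) 1 q⁻¹ + q * appell (q ^ 5) (q ^ 2) q
      = lambert (q ^ 5) (q ^ 3) - lambert (q ^ 5) (q ^ 2) - lambert (q ^ 5) (q ^ 4)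
        + lambert (q ^ 5) q := by
  have hp0 := pow_ne_zero 5 hq0
  have ha := pow_mul_zpow_ne_one hq0 hq1 (k := 1) (by norm_num)
  have h1 := laurentCoeff_pow hq0 hq1 (k := 1) (l := 4) (by norm_num) (by norm_num) rfl
  have h0 := theta_pow_ne_zero hq0 hq1 (k := 1) (l := 4) (by norm_num) (by norm_num) rfl
  rw [pow_one] at ha h1 h0
  -- Here a = q and z = q^2, so a/z = q⁻¹.
  have h := theta_mul_appell_sub hp0 (norm_pow_lt_one hq1 (by norm_num)) hq0 (pow_ne_zero 2 hq0)
    ha (pow_mul_zpow_ne_one hq0 hq1 (by norm_num))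
  have ht : theta (q ^ 5) q = -q * theta (q ^ 5) q⁻¹ := by
    rw [theta_inv hp0, ← theta_mul_left hp0 hq0]
  rw [show q / q ^ 2 = q⁻¹ by field_simp, h1,
    laurentCoeff_pow hq0 hq1 (k := 2) (l := 3) (by norm_num) (by norm_num) rfl] at h
  refine mul_left_cancel₀ h0 ?_
  linear_combination h + q * appell (q ^ 5) (q ^ 2) q * ht

/-! ### Reduction of (A), (B) and (C) to Lambert series -/

theorem neg_one_zpow_mul_zpow_div (hq0 : q ≠ 0) {m e c d s : ℤ} (w x : ℂ)
    (he : e = 5 * m ^ 2 + (5 + 2 * c) * m + 2 * s) (hx : x = q ^ c)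
    (hd : q ^ d = w * (q ^ 5) ^ m) :
    (-1) ^ m * (q ^ (e / 2) / (1 - q ^ d)) = q ^ s * appellTerm (q ^ 5) w x m := by
  have he' : e / 2 = s + (5 * tri (m + 1) + c * m) := by
    refine Int.ediv_eq_of_eq_mul_right two_ne_zero ?_
    linarith [two_mul_tri (m + 1), show (m + 1) * (m + 1 - 1) = m ^ 2 + m by ring]
  have h : q ^ (e / 2) = q ^ s * ((q ^ 5) ^ tri (m + 1) * x ^ m) := by
    rw [he', hx, ← zpow_natCast q 5, ← zpow_mul, ← zpow_mul, ← zpow_add₀ hq0, ← zpow_add₀ hq0]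
    rfl
  rw [h, hd, appellTerm]
  ring

theorem termA1_eq (hq0 : q ≠ 0) (m : ℤ) :
    termA1 q m = q⁻¹ * appellTerm (q ^ 5) 1 (q ^ 2)⁻¹ m := by
  rw [termA1, ← zpow_neg_one]
  refine neg_one_zpow_mul_zpow_div hq0 (c := -2) _ _ (by ring) ?_ ?_
  · rw [zpow_neg]; rfl
  · rw [zpow_mul, one_mul]; rfl

theorem termA2_eq (hq0 : q ≠ 0) (m : ℤ) :
    termA2 q m = q⁻¹ * appellTerm (q ^ 5) q⁻¹ (q ^ 3)⁻¹ m := by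
  rw [termA2, ← zpow_neg_one]
  refine neg_one_zpow_mul_zpow_div hq0 (c := -3) _ _ (by ring) ?_ ?_
  · rw [zpow_neg]; rfl
  · rw [sub_eq_neg_add, zpow_add₀ hq0, zpow_mul]; rfl

theorem termA3_eq (hq0 : q ≠ 0) (m : ℤ) :
    termA3 q m = q⁻¹ * appellTerm (q ^ 5) 1 q⁻¹ m := by
  rw [termA3, ← zpow_neg_one]
  refine neg_one_zpow_mul_zpow_div hq0 (c := -1) _ _ (by ring) rfl ?_
  rw [zpow_mul, one_mul]; rfl

theorem termA4_eq (hq0 : q ≠ 0) (m : ℤ) :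
    termA4 q m = appellTerm (q ^ 5) (q ^ 2) q m := by
  rw [termA4, ← one_mul (appellTerm _ _ _ _), ← zpow_zero q]
  refine neg_one_zpow_mul_zpow_div hq0 (c := 1) _ _ (by ring) (zpow_one q).symm ?_
  rw [add_comm, zpow_add₀ hq0, zpow_mul]; rfl

theorem summable_termA (hq0 : q ≠ 0) (hq1 : ‖q‖ < 1) :
    Summable (termA1 q) ∧ Summable (termA2 q) ∧ Summable (termA3 q) ∧ Summable (termA4 q) := by
  have h (w : ℂ) {x : ℂ} (hx : x ≠ 0) : Summable (appellTerm (q ^ 5) w x) :=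
    (summable_norm_appellTerm (pow_ne_zero 5 hq0) (norm_pow_lt_one hq1 (by norm_num)) w hx).of_norm
  exact ⟨((h _ (inv_ne_zero (pow_ne_zero 2 hq0))).mul_left _).congr (termA1_eq hq0 · |>.symm),
    ((h _ (inv_ne_zero (pow_ne_zero 3 hq0))).mul_left _).congr (termA2_eq hq0 · |>.symm),
    ((h _ (inv_ne_zero hq0)).mul_left _).congr (termA3_eq hq0 · |>.symm),
    (h _ hq0).congr (termA4_eq hq0 · |>.symm)⟩

/-- Dropping the index `0` does not change a sum whose summand vanishes there. -/
theorem tsum_ne_zero_eq {f : ℤ → ℂ} (hf : f 0 = 0) :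
    ∑' m : {m : ℤ // m ≠ 0}, f m = ∑' m, f m :=
  tsum_subtype_eq_of_support_subset (s := {m : ℤ | m ≠ 0}) fun _ hm h => hm (h ▸ hf)

/-- The common value of the left-hand sides, multiplied by `q`. -/
def lambertSum (q : ℂ) : ℂ :=
  lambert (q ^ 5) q - lambert (q ^ 5) (q ^ 4) - 3 * lambert (q ^ 5) (q ^ 2)
    + 3 * lambert (q ^ 5) (q ^ 3)

theorem lhsA_eq (hq0 : q ≠ 0) (hq1 : ‖q‖ < 1) : lhsA q = q⁻¹ * lambertSum q := by
  have hp0 := pow_ne_zero 5 hq0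
  have r1 := appell_reflect hp0 one_ne_zero (q ^ 2)⁻¹
  have r2 := appell_reflect hp0 (inv_ne_zero hq0) (q ^ 3)⁻¹
  rw [inv_one, inv_inv, neg_one_mul] at r1
  rw [inv_inv, inv_inv] at r2
  -- The omitted m = 0 summands are 0 by division by zero, so full sums may be used.
  rw [lhsA, tsum_ne_zero_eq (f := termA1 q) (by simp [termA1]),
    tsum_ne_zero_eq (f := termA3 q) (by simp [termA3])]
  simp only [termA1_eq hq0, termA2_eq hq0, termA3_eq hq0, termA4_eq hq0, tsum_mul_left]
  rw [← appell, ← appell, ← appell, ← appell, r1, r2, lambertSum]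
  have hqq := inv_mul_cancel₀ hq0
  -- Weights 1 and 2 on the two pairs produce the coefficients 1, -1, -3, 3.
  linear_combination q⁻¹ * appell_sub_eq_lambert hq0 hq1
    + 2 * q⁻¹ * appell_add_eq_lambert hq0 hq1 - 2 * appell (q ^ 5) (q ^ 2) q * hqq

theorem hasSum_termB (hq1 : ‖q‖ < 1) : HasSum (termB q) (q * lambertSum q) := by
  have h {k : ℕ} (hk : k ≠ 0) := hasSum_lambert (norm_pow_lt_one hq1 (k := 5) (by norm_num))
    (norm_pow_lt_one hq1 hk)
  have h1 := h (k := 1) (by norm_num)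
  rw [pow_one] at h1
  refine ((((h1.sub (h (k := 4) (by norm_num))).sub
    ((h (k := 2) (by norm_num)).mul_left 3)).add
    ((h (k := 3) (by norm_num)).mul_left 3)).mul_left q).congr_fun fun j => ?_
  simp only [termB, pow_add, pow_mul]
  ring

/-- With x = q^(m+1) the numerator is q⁻¹ (x - 3x² + 3x³ - x⁴); the x^k part is the swapped Lambert
series at q^k. -/
theorem hasSum_termC (hq0 : q ≠ 0) (hq1 : ‖q‖ < 1) : HasSum (termC q) (q⁻¹ * lambertSum q) := by
  have h {k : ℕ} (hk : k ≠ 0) := hasSum_lambert_swap (norm_pow_lt_one hq1 (k := 5) (by norm_num))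
    (norm_pow_lt_one hq1 hk)
  have h1 := h (k := 1) (by norm_num)
  rw [pow_one] at h1
  refine ((((h1.sub (h (k := 4) (by norm_num))).sub
    ((h (k := 2) (by norm_num)).mul_left 3)).add
    ((h (k := 3) (by norm_num)).mul_left 3)).mul_left q⁻¹).congr_fun fun m => ?_
  have h5 : q ^ (5 * m + 5) = (q ^ 5) ^ (m + 1) := by ring
  have hm : q ^ m = q⁻¹ * q ^ (m + 1) := by rw [pow_succ']; field_simp
  rw [termC, h5, hm]
  ring

end CrankModFive

end

open CrankModFive in
theorem theorem4p5 (q : ℂ) (hq0 : q ≠ 0) (hq1 : ‖q‖ < 1) :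
    -- every series involved converges absolutely
    (Summable (fun m : {m : ℤ // m ≠ 0} => termA1 q m) ∧ Summable (termA2 q) ∧
      Summable (fun m : {m : ℤ // m ≠ 0} => termA3 q m) ∧ Summable (termA4 q) ∧
      Summable (termB q) ∧ Summable (termC q)) ∧
    -- the three left-hand sides agree
    (lhsA q = lhsB q ∧ lhsB q = lhsC q) ∧
    -- the three identities are equivalent
    ((FormA q ↔ FormB q) ∧ (FormB q ↔ FormC q) ∧ (FormA q ↔ FormC q)) := by
  obtain ⟨h1, h2, h3, h4⟩ := summable_termA hq0 hq1
  have hB := hasSum_termB hq1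
  have hC := hasSum_termC hq0 hq1
  have hA := lhsA_eq hq0 hq1
  have hAB : lhsA q = lhsB q := by
    rw [hA, lhsB, hB.tsum_eq]
    field_simp
  have hBC : lhsB q = lhsC q := by rw [← hAB, hA, lhsC, hC.tsum_eq]
  refine ⟨⟨h1.comp_injective Subtype.val_injective, h2, h3.comp_injective Subtype.val_injective,
    h4, hB.summable, hC.summable⟩, ⟨hAB, hBC⟩, ?_⟩
  simp only [FormA, FormB, FormC, hAB, hBC, iff_self, and_self]
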